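/- Let $R$ be a commutative artinian ring and let $\Lambda$ be an artin $R$-algebra, i.e. an $R$-algebra that is finitely generated as an $R$-module. For a ring $A$ let $\mathrm{mod}\,A$ denote the category of finitely generated right $A$-modules; $A$ is of \emph{finite representation type} if $\mathrm{mod}\,A$ has only finitely many isomorphism classes of indecomposable objects. Let $n\ge 2$ and let $M\in\mathrm{mod}\,\Lambda$ be an $n$-cluster tilting module, that is, the class $\mathcal M=\mathrm{add}\,M$ of direct summands of finite direct sums of copies of $M$ is a functorially finite, generating and cogenerating subcategory of $\mathrm{mod}\,\Lambda$ such that $$\mathcal M=\{X\in\mathrm{mod}\,\Lambda \mid \mathrm{Ext}^i_\Lambda(\mathcal M,X)=0 \text{ for all } 0<i<n\}=\{X\in\mathrm{mod}\,\Lambda \mid \mathrm{Ext}^i_\Lambda(X,\mathcal M)=0 \text{ for all } 0<i<n\}.$$ If $\Lambda$ is of finite representation type, then the stable endomorphism algebra $\underline{\mathrm{End}}_\Lambda(M)$, the quotient of $\mathrm{End}_\Lambda(M)$ by the two-sided ideal of the endomorphisms that factor through a projective module in $\mathrm{mod}\,\Lambda$, is of finite representation type. -/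

import Mathlib

open CategoryTheory

universe u

namespace RepTheory

section Modules

variable (A : Type u) [Ring A]

/-- The set of isomorphism classes of finitely generated indecomposable left `A`-modules. -/
def indecomposableClasses : Set (Quotient (isIsomorphicSetoid (ModuleCat.{u} A))) :=
  {c | ∃ N : ModuleCat.{u} A, Module.Finite A N ∧ Indecomposable N ∧ Quotient.mk _ N = c}

/-- `A` is of finite representation type: up to isomorphism there are only finitely many
indecomposable objects in `mod A`, the category of finitely generated *right* `A`-modules
(right `A`-modules are left modules over the opposite ring). -/
def FiniteRepType : Prop := (indecomposableClasses Aᵐᵒᵖ).Finite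

variable {A}

/-- `add M`: the modules that are direct summands of a finite direct sum of copies of `M`. -/
def addClosure (M : ModuleCat.{u} A) : ObjectProperty (ModuleCat.{u} A) := fun X =>
  ∃ (k : ℕ) (s : X →ₗ[A] (Fin k → M)) (r : (Fin k → M) →ₗ[A] X), r ∘ₗ s = LinearMap.id

/-- A full subcategory `𝓜` of the category of finitely generated `A`-modules (given by the class of
its objects) is `n`-cluster tilting. -/
structure IsClusterTiltingSubcategory (n : ℕ) (𝓜 : ObjectProperty (ModuleCat.{u} A)) : Prop where
  /-- the objects of `𝓜` are finitely generated -/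
  finite : ∀ X, 𝓜 X → Module.Finite A X
  /-- every finitely generated module has a right `𝓜`-approximation -/
  contravariantlyFinite : ∀ X : ModuleCat.{u} A, Module.Finite A X →
    ∃ (Y : ModuleCat.{u} A) (π : Y ⟶ X), 𝓜 Y ∧
      ∀ (Z : ModuleCat.{u} A) (f : Z ⟶ X), 𝓜 Z → ∃ g : Z ⟶ Y, g ≫ π = f
  /-- every finitely generated module has a left `𝓜`-approximation -/
  covariantlyFinite : ∀ X : ModuleCat.{u} A, Module.Finite A X →
    ∃ (Y : ModuleCat.{u} A) (ι : X ⟶ Y), 𝓜 Y ∧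
      ∀ (Z : ModuleCat.{u} A) (f : X ⟶ Z), 𝓜 Z → ∃ g : Y ⟶ Z, ι ≫ g = f
  /-- every finitely generated module is a quotient of an object of `𝓜` -/
  generating : ∀ X : ModuleCat.{u} A, Module.Finite A X →
    ∃ (Y : ModuleCat.{u} A) (π : Y ⟶ X), 𝓜 Y ∧ Epi π
  /-- every finitely generated module embeds into an object of `𝓜` -/
  cogenerating : ∀ X : ModuleCat.{u} A, Module.Finite A X →
    ∃ (Y : ModuleCat.{u} A) (ι : X ⟶ Y), 𝓜 Y ∧ Mono ι
  /-- `𝓜` consists of the `X` with `Ext^i(𝓜, X) = 0` for all `0 < i < n` -/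
  right_perp : ∀ X : ModuleCat.{u} A, Module.Finite A X →
    (𝓜 X ↔ ∀ Y, 𝓜 Y → ∀ i, 0 < i → i < n → Subsingleton (Abelian.Ext Y X i))
  /-- `𝓜` consists of the `X` with `Ext^i(X, 𝓜) = 0` for all `0 < i < n` -/
  left_perp : ∀ X : ModuleCat.{u} A, Module.Finite A X →
    (𝓜 X ↔ ∀ Y, 𝓜 Y → ∀ i, 0 < i → i < n → Subsingleton (Abelian.Ext X Y i))

/-- A finitely generated module `M` is an `n`-cluster tilting module if `add M` is an `n`-cluster
tilting subcategory of the category of finitely generated modules. -/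
def IsClusterTiltingModule (n : ℕ) (M : ModuleCat.{u} A) : Prop :=
  Module.Finite A M ∧ IsClusterTiltingSubcategory n (addClosure M)

/-- An endomorphism of `M` factors through a finitely generated projective module. -/
def FactorsThroughProjective {M : ModuleCat.{u} A} (f : Module.End A M) : Prop :=
  ∃ P : ModuleCat.{u} A, Module.Finite A P ∧ Module.Projective A P ∧
    ∃ (g : M →ₗ[A] P) (h : P →ₗ[A] M), f = h ∘ₗ g

/-- The two-sided ideal of `End_A(M)` of the endomorphisms factoring through a projective. -/
def projectiveIdeal (M : ModuleCat.{u} A) : TwoSidedIdeal (Module.End A M) :=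
  TwoSidedIdeal.mk' {f | FactorsThroughProjective f}
    ⟨ModuleCat.of A PUnit.{u+1}, inferInstanceAs (Module.Finite A PUnit.{u+1}),
      inferInstanceAs (Module.Projective A PUnit.{u+1}), 0, 0, by ext; simp⟩
    (by
      rintro f f' ⟨P, hP, hP', g, h, rfl⟩ ⟨Q, hQ, hQ', g', h', rfl⟩
      exact ⟨ModuleCat.of A (P × Q), inferInstanceAs (Module.Finite A (P × Q)),
        inferInstanceAs (Module.Projective A (P × Q)), g.prod g', h.coprod h', by ext; simp⟩)
    (by
      rintro f ⟨P, hP, hP', g, h, rfl⟩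
      exact ⟨P, hP, hP', g, -h, by ext; simp⟩)
    (by
      rintro e f ⟨P, hP, hP', g, h, rfl⟩
      exact ⟨P, hP, hP', g, e ∘ₗ h, by ext; simp⟩)
    (by
      rintro f e ⟨P, hP, hP', g, h, rfl⟩
      exact ⟨P, hP, hP', g ∘ₗ e, h, by ext; simp⟩)

/-- The defining property of `projectiveIdeal`. -/
theorem mem_projectiveIdeal {M : ModuleCat.{u} A} {f : Module.End A M} :
    f ∈ projectiveIdeal M ↔ FactorsThroughProjective f := by
  exact TwoSidedIdeal.mem_mk' _ _ _ _ _ _ _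

/-- The stable endomorphism ring of `M`: the quotient of `End_A(M)` (whose product is composition)
by the ideal of the endomorphisms factoring through a projective. -/
abbrev StableEnd (M : ModuleCat.{u} A) : Type u := (projectiveIdeal M).ringCon.Quotient

end Modules

end RepTheory

namespace RepTheory

/-! ### Indecomposable modules and decompositions of modules of finite length. -/

section Indecomposable

variable {A : Type u} [Ring A]

/-! Every indecomposable finitely generated right module `F` over the stable endomorphism ring is
`Ext¹(M, N)` for some indecomposable `N`, so there are at most as many such `F` as `N`. Regard `F`
as a right `End M`-module and present it as the cokernel of `Hom(M, f)` for some `f : M^k → M^m`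
(`exists_equiv_homCokernel`). Maps through projectives kill `F` and the ring lies in `add M`, so `f`
is onto (`surjective_of_homCokernel`). Since `Ext¹(M, M^k) = 0`, the long exact sequence gives `F ≅
Ext¹(M, ker f)`. Decomposing the finite length module `ker f` makes `F` a product of modules
`Ext¹(M, N i)` (`nonempty_homCokernel_equiv_pi_extModule`), and indecomposability leaves one factor.
-/

theorem Indecomposable.nontrivial {N : ModuleCat.{u} A} (hN : Indecomposable N) : Nontrivial N := by
  by_contra h
  rw [not_nontrivial_iff_subsingleton] at h
  exact hN.1 (ModuleCat.isZero_of_subsingleton N)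

/-- An idempotent splits `N` as range plus kernel, and one of the two must vanish. -/
theorem Indecomposable.eq_zero_or_eq_one {N : ModuleCat.{u} A} (hN : Indecomposable N)
    {e : Module.End A N} (he : IsIdempotentElem e) : e = 0 ∨ e = 1 := by
  have hc : IsCompl (LinearMap.range e) (LinearMap.ker e) :=
    LinearMap.IsIdempotentElem.isCompl he
  have i : N ≅ ModuleCat.of A (LinearMap.range e) ⊞ ModuleCat.of A (LinearMap.ker e) :=
    (Submodule.prodEquivOfIsCompl _ _ hc).symm.toModuleIso ≪≫
      (ModuleCat.biprodIsoProd (ModuleCat.of A (LinearMap.range e))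
        (ModuleCat.of A (LinearMap.ker e))).symm
  rcases hN.2 _ _ i with h | h
  · left
    have := ModuleCat.subsingleton_of_isZero h
    rw [← LinearMap.range_eq_bot]
    exact (Submodule.subsingleton_iff_eq_bot).1 this
  · right
    have := ModuleCat.subsingleton_of_isZero h
    have hk : LinearMap.ker e = ⊥ := (Submodule.subsingleton_iff_eq_bot).1 this
    ext x
    refine LinearMap.ker_eq_bot.1 hk ?_
    exact LinearMap.congr_fun he x

/-- A module of finite length is a finite product of indecomposable modules. -/
theorem exists_equiv_pi_indecomposable (X : ModuleCat.{u} A) [IsNoetherian A X] [IsArtinian A X] :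
    ∃ (ι : Type) (_ : Finite ι) (N : ι → ModuleCat.{u} A),
      (∀ i, Module.Finite A (N i) ∧ Indecomposable (N i)) ∧ Nonempty (X ≃ₗ[A] ∀ i, N i) := by
  obtain ⟨l, hl⟩ : ∃ l : ℕ, Module.length A X = l :=
    ⟨_, (ENat.natCast_toNat (Module.length_ne_top (R := A) (M := X))).symm⟩
  induction l using Nat.strong_induction_on generalizing X with
  | _ l ih =>
    by_cases hX : Indecomposable X
    · exact ⟨Unit, inferInstance, fun _ => X, fun _ => ⟨inferInstance, hX⟩,
        ⟨(LinearEquiv.funUnique Unit A X).symm⟩⟩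
    by_cases h0 : Subsingleton X
    · exact ⟨Empty, inferInstance, fun _ => X, fun i => i.elim, ⟨0⟩⟩
    have hz : ¬ Limits.IsZero X := fun h => h0 (ModuleCat.subsingleton_of_isZero h)
    obtain ⟨Y, Z, ⟨i⟩, hY, hZ⟩ : ∃ Y Z, Nonempty (X ≅ Y ⊞ Z) ∧ ¬ Limits.IsZero Y ∧
        ¬ Limits.IsZero Z := by
      by_contra! h
      exact hX ⟨hz, fun Y Z i => or_iff_not_imp_left.2 fun hY => h Y Z ⟨i⟩ hY⟩
    have e : X ≃ₗ[A] Y × Z := (i ≪≫ ModuleCat.biprodIsoProd Y Z).toLinearEquiv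
    have hYn : IsNoetherian A Y := isNoetherian_of_surjective (LinearMap.fst A Y Z ∘ₗ e.toLinearMap)
      (by rw [LinearMap.range_eq_top]; exact Prod.fst_surjective.comp e.surjective)
    have hZn : IsNoetherian A Z := isNoetherian_of_surjective (LinearMap.snd A Y Z ∘ₗ e.toLinearMap)
      (by rw [LinearMap.range_eq_top]; exact Prod.snd_surjective.comp e.surjective)
    have hYa : IsArtinian A Y := isArtinian_of_surjective _ (LinearMap.fst A Y Z ∘ₗ e.toLinearMap)
      (Prod.fst_surjective.comp e.surjective)
    have hZa : IsArtinian A Z := isArtinian_of_surjective _ (LinearMap.snd A Y Z ∘ₗ e.toLinearMap)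
      (Prod.snd_surjective.comp e.surjective)
    obtain ⟨a, ha⟩ : ∃ l : ℕ, Module.length A Y = l :=
      ⟨_, (ENat.natCast_toNat (Module.length_ne_top (R := A) (M := Y))).symm⟩
    obtain ⟨b, hb⟩ : ∃ l : ℕ, Module.length A Z = l :=
      ⟨_, (ENat.natCast_toNat (Module.length_ne_top (R := A) (M := Z))).symm⟩
    have hab : l = a + b := by
      have := e.length_eq
      rw [Module.length_prod, ha, hb, hl] at this
      exact_mod_cast this
    have hpos : ∀ (W : ModuleCat.{u} A) (c : ℕ), ¬ Limits.IsZero W → Module.length A W = c →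
        0 < c := by
      intro W c hW hc
      have : Nontrivial W := by
        by_contra h
        rw [not_nontrivial_iff_subsingleton] at h
        exact hW (ModuleCat.isZero_of_subsingleton W)
      have := Module.length_pos (R := A) (M := W)
      rw [hc] at this
      exact_mod_cast this
    have ha0 := hpos Y a hY ha
    have hb0 := hpos Z b hZ hb
    obtain ⟨ι, _, N, hN, ⟨eN⟩⟩ := ih a (by omega) Y ha
    obtain ⟨κ, _, K, hK, ⟨eK⟩⟩ := ih b (by omega) Z hb
    refine ⟨ι ⊕ κ, inferInstance, Sum.elim N K, ?_, ⟨e ≪≫ₗ eN.prodCongr eK ≪≫ₗ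
      (LinearEquiv.sumPiEquivProdPi A ι κ fun s => (Sum.elim N K s : ModuleCat.{u} A)).symm⟩⟩
    rintro (i | i)
    · exact hN i
    · exact hK i

end Indecomposable

/-- A nontrivial module without nontrivial idempotent endomorphisms that is a product of modules is
isomorphic to one of the factors. -/
theorem exists_equiv_of_equiv_pi {B : Type*} [Ring B] {F : Type*} [AddCommGroup F] [Module B F]
    [Nontrivial F] (hF : ∀ e : Module.End B F, IsIdempotentElem e → e = 0 ∨ e = 1)
    {ι : Type*} {D : ι → Type*} [∀ i, AddCommGroup (D i)] [∀ i, Module B (D i)]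
    (e : F ≃ₗ[B] ∀ i, D i) : ∃ i, Nonempty (F ≃ₗ[B] D i) := by
  classical
  let π : ∀ i, F →ₗ[B] D i := fun i => LinearMap.proj i ∘ₗ e.toLinearMap
  let σ : ∀ i, D i →ₗ[B] F := fun i => e.symm.toLinearMap ∘ₗ LinearMap.single B D i
  have hπσ : ∀ i x, π i (σ i x) = x := fun i x => by simp [π, σ]
  by_contra! h
  obtain ⟨x, hx⟩ := exists_ne (0 : F)
  apply hx
  apply e.injective
  ext i
  -- If `σ i ∘ π i = 1`, then `F ≅ D i`, which is excluded; so every coordinate `π i x` vanishes and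
  -- `x = 0`.
  have hi : IsIdempotentElem (σ i ∘ₗ π i) := by
    ext y
    simp [hπσ]
  rcases hF _ hi with h0 | h1
  · have := LinearMap.congr_fun h0 x
    have h2 : π i (σ i (π i x)) = 0 := by
      rw [← LinearMap.comp_apply (σ i), this]; simp
    rw [hπσ] at h2
    simpa [π] using h2
  · exact ((h i).false (LinearEquiv.ofLinearMap (π i) (σ i) (LinearMap.ext (hπσ i)) h1)).elim

/-! ### Cokernels of `Hom(M, f)` as right `End M`-modules. -/

section HomCokernel

variable {A : Type*} [Ring A] (M : Type*) [AddCommGroup M] [Module A M]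
  {Y Z I C : Type*} [AddCommGroup Y] [Module A Y] [AddCommGroup Z] [Module A Z]
  [AddCommGroup I] [Module A I] [AddCommGroup C] [Module A C]

/-- `Hom(M, Y)` is a right `End M`-module by composition. -/
instance precompModule : Module (Module.End A M)ᵐᵒᵖ (M →ₗ[A] Y) where
  smul e φ := φ ∘ₗ e.unop
  one_smul _ := rfl
  mul_smul _ _ _ := rfl
  smul_zero _ := rfl
  smul_add _ _ _ := rfl
  add_smul d e φ := LinearMap.comp_add d.unop e.unop φ
  zero_smul φ := LinearMap.comp_zero φ

variable {M} in
theorem op_smul_eq_comp (e : (Module.End A M)ᵐᵒᵖ) (φ : M →ₗ[A] Y) : e • φ = φ ∘ₗ e.unop := rfl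

/-- Composition with `f`, as a map of right `End M`-modules `Hom(M, Y) → Hom(M, Z)`. -/
def postcomp (f : Y →ₗ[A] Z) : (M →ₗ[A] Y) →ₗ[(Module.End A M)ᵐᵒᵖ] (M →ₗ[A] Z) where
  toFun φ := f ∘ₗ φ
  map_add' φ ψ := LinearMap.comp_add φ ψ f
  map_smul' _ _ := rfl

@[simp]
theorem postcomp_apply (f : Y →ₗ[A] Z) (φ : M →ₗ[A] Y) : postcomp M f φ = f ∘ₗ φ := rfl

/-- The cokernel of `Hom(M, Y) → Hom(M, Z)`, a right `End M`-module. -/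
abbrev HomCokernel (f : Y →ₗ[A] Z) := (M →ₗ[A] Z) ⧸ LinearMap.range (postcomp M f)

/-- `M` lifts along all surjections with kernel isomorphic to `Y`; that is, `Ext¹(M, Y) = 0`. -/
def LiftsAlongExtensionsBy (Y : Type u) [AddCommGroup Y] [Module A Y] : Prop :=
  ∀ (B C : Type u) [AddCommGroup B] [AddCommGroup C] [Module A B] [Module A C]
    (i : Y →ₗ[A] B) (g : B →ₗ[A] C), Function.Injective i → Function.Surjective g →
    Function.Exact i g → ∀ φ : M →ₗ[A] C, ∃ ψ : M →ₗ[A] B, g ∘ₗ ψ = φ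

end HomCokernel

/-- The obstruction to lifting `φ` is its image in `Ext¹(M, Y)` under the connecting map. -/
theorem liftsAlongExtensionsBy_of_subsingleton_ext {A : Type u} [Ring A] {M Y : ModuleCat.{u} A}
    (h : Subsingleton (Abelian.Ext M Y 1)) : LiftsAlongExtensionsBy (A := A) M Y := by
  intro B C _ _ _ _ i g hi hg hig φ
  let S : ShortComplex (ModuleCat.{u} A) :=
    ShortComplex.mk (X₁ := Y) (X₂ := ModuleCat.of A B) (X₃ := ModuleCat.of A C)
      (ModuleCat.ofHom i) (ModuleCat.ofHom g)
      (by rw [← ModuleCat.ofHom_comp, hig.linearMap_comp_eq_zero]; rfl)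
  have hS : S.ShortExact := ModuleCat.shortComplex_shortExact S hig hi hg
  obtain ⟨x, hx⟩ := Abelian.Ext.covariant_sequence_exact₃ M hS
    (Abelian.Ext.mk₀ (ModuleCat.ofHom φ : M ⟶ S.X₃)) (zero_add 1) (Subsingleton.elim _ _)
  obtain ⟨ψ, rfl⟩ := Abelian.Ext.addEquiv₀.symm.surjective x
  rw [Abelian.Ext.addEquiv₀_symm_apply, Abelian.Ext.mk₀_comp_mk₀] at hx
  have := Abelian.Ext.addEquiv₀.symm.injective hx
  exact ⟨ψ.hom, by simpa [S] using congrArg ModuleCat.Hom.hom this⟩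

section HomCokernel

variable {A : Type*} [Ring A] {M : Type*} [AddCommGroup M] [Module A M]
  {Y Z I C : Type u} [AddCommGroup Y] [Module A Y] [AddCommGroup Z] [Module A Z]
  [AddCommGroup I] [Module A I] [AddCommGroup C] [Module A C]

/-- Two surjections with isomorphic kernels have isomorphic Hom-cokernels, if the isomorphism of the
kernels is induced by a map from a module `Y` with `Ext¹(M, Y) = 0`. -/
theorem nonempty_homCokernel_equiv (hY : LiftsAlongExtensionsBy (A := A) M Y)
    (f : Y →ₗ[A] Z) (p : I →ₗ[A] C) (u : Y →ₗ[A] I)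
    (hf : Function.Surjective f) (hp : Function.Surjective p)
    (hu : ∀ y, f y = 0 → p (u y) = 0)
    (hinj : ∀ y, f y = 0 → u y = 0 → y = 0)
    (hsurj : ∀ w, p w = 0 → ∃ y, f y = 0 ∧ u y = w) :
    Nonempty (HomCokernel M f ≃ₗ[(Module.End A M)ᵐᵒᵖ] HomCokernel M p) := by
  obtain ⟨v, hv⟩ : ∃ v : Z →ₗ[A] C, v ∘ₗ f = p ∘ₗ u := by
    have hle : LinearMap.ker f ≤ LinearMap.ker (p ∘ₗ u) := fun y hy => hu y hy
    refine ⟨(LinearMap.ker f).liftQ (p ∘ₗ u) hle ∘ₗ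
      (f.quotKerEquivOfSurjective hf).symm.toLinearMap, ?_⟩
    ext y
    have : (f.quotKerEquivOfSurjective hf).symm (f y) = Submodule.Quotient.mk y := by
      rw [LinearEquiv.symm_apply_eq]; rfl
    simp [this]
  have hv' : ∀ y, v (f y) = p (u y) := fun y => LinearMap.congr_fun hv y
  -- The square of `u`, `f`, `p`, `v` is bicartesian because `u` identifies the two kernels;
  -- equivalently, `0 → Y → I × Z → C → 0` is exact.
  let i : Y →ₗ[A] I × Z := u.prod f
  let g : I × Z →ₗ[A] C := p.coprod (-v)
  have hi : Function.Injective i := by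
    rw [injective_iff_map_eq_zero]
    intro y hy
    exact hinj y (congrArg Prod.snd hy) (congrArg Prod.fst hy)
  have hg : Function.Surjective g := fun c => by
    obtain ⟨w, rfl⟩ := hp c
    exact ⟨(w, 0), by simp [g]⟩
  have hig : Function.Exact i g := by
    rintro ⟨w, z⟩
    constructor
    · intro h
      have h' : p w = v z := by simpa [g, ← sub_eq_add_neg, sub_eq_zero] using h
      obtain ⟨y, rfl⟩ := hf z
      obtain ⟨y', hy', hw⟩ := hsurj (w - u y) (by rw [map_sub, h', hv', sub_self])
      exact ⟨y' + y, by simp [i, hy', hw]⟩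
    · rintro ⟨y, hy⟩
      rw [← hy]
      simp [i, g, hv']
  let T : HomCokernel M f →ₗ[(Module.End A M)ᵐᵒᵖ] HomCokernel M p :=
    Submodule.mapQ _ _ (postcomp M v) (by
      rintro _ ⟨ψ, rfl⟩
      refine ⟨u ∘ₗ ψ, ?_⟩
      ext m
      simp [hv'])
  refine ⟨LinearEquiv.ofBijective T ⟨?_, ?_⟩⟩
  · rw [injective_iff_map_eq_zero]
    intro x hx
    obtain ⟨φ, rfl⟩ := Submodule.Quotient.mk_surjective _ x
    obtain ⟨χ, hχ⟩ : v ∘ₗ φ ∈ LinearMap.range (postcomp M p) :=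
      (Submodule.Quotient.mk_eq_zero _).1 hx
    rw [Submodule.Quotient.mk_eq_zero]
    have hχ' : ∀ m, p (χ m) = v (φ m) := fun m => LinearMap.congr_fun hχ m
    -- `Y` is the pullback of `p` and `v`, so `χ` and `φ` together define a map to `Y` that lifts
    -- `φ` along `f`.
    have hr : ∀ m, (χ.prod φ) m ∈ LinearMap.range i := fun m =>
      (hig _).1 (by simp [g, hχ'])
    let ψ : M →ₗ[A] Y := (LinearEquiv.ofInjective i hi).symm.toLinearMap ∘ₗ
      (χ.prod φ).codRestrict _ hr
    refine ⟨ψ, ?_⟩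
    ext m
    have : i (ψ m) = (χ.prod φ) m :=
      congrArg Subtype.val ((LinearEquiv.ofInjective i hi).apply_symm_apply
        ((χ.prod φ).codRestrict _ hr m))
    exact congrArg Prod.snd this
  · intro x
    obtain ⟨φ, rfl⟩ := Submodule.Quotient.mk_surjective _ x
    -- A lift `ψ = (w, z)` satisfies `p w - v z = φ`, so `-z` maps to `φ` modulo the image of `p`.
    obtain ⟨ψ, hψ⟩ := hY (I × Z) C i g hi hg hig φ
    refine ⟨Submodule.Quotient.mk (-(LinearMap.snd A I Z ∘ₗ ψ)), ?_⟩
    change Submodule.Quotient.mk (v ∘ₗ (-(LinearMap.snd A I Z ∘ₗ ψ))) = _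
    rw [Submodule.Quotient.eq]
    refine ⟨-(LinearMap.fst A I Z ∘ₗ ψ), ?_⟩
    ext m
    have := LinearMap.congr_fun hψ m
    simp [g, ← this]

end HomCokernel

section Pi

variable {A : Type*} [Ring A] (M : Type*) [AddCommGroup M] [Module A M]
  {ι : Type*} {I C : ι → Type*} [∀ i, AddCommGroup (I i)] [∀ i, Module A (I i)]
  [∀ i, AddCommGroup (C i)] [∀ i, Module A (C i)]

/-- The Hom-cokernel of a product of maps is the product of the Hom-cokernels. -/
theorem nonempty_homCokernel_piMap_equiv (p : ∀ i, I i →ₗ[A] C i) :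
    Nonempty (HomCokernel M (LinearMap.piMap p) ≃ₗ[(Module.End A M)ᵐᵒᵖ]
      ∀ i, HomCokernel M (p i)) := by
  let T : HomCokernel M (LinearMap.piMap p) →ₗ[(Module.End A M)ᵐᵒᵖ] ∀ i, HomCokernel M (p i) :=
    LinearMap.pi fun i => Submodule.mapQ _ _ (postcomp M (LinearMap.proj i)) (by
      rintro _ ⟨ψ, rfl⟩
      refine ⟨LinearMap.proj i ∘ₗ ψ, ?_⟩
      ext m
      simp)
  refine ⟨LinearEquiv.ofBijective T ⟨?_, ?_⟩⟩
  · rw [injective_iff_map_eq_zero]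
    intro x hx
    obtain ⟨φ, rfl⟩ := Submodule.Quotient.mk_surjective _ x
    rw [Submodule.Quotient.mk_eq_zero]
    have h : ∀ i, LinearMap.proj i ∘ₗ φ ∈ LinearMap.range (postcomp M (p i)) := fun i =>
      (Submodule.Quotient.mk_eq_zero _).1 (congrFun hx i)
    choose ψ hψ using h
    refine ⟨LinearMap.pi ψ, ?_⟩
    ext m i
    exact LinearMap.congr_fun (hψ i) m
  · intro x
    choose φ hφ using fun i => Submodule.Quotient.mk_surjective _ (x i)
    refine ⟨Submodule.Quotient.mk (LinearMap.pi φ), ?_⟩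
    ext i
    rw [← hφ i]
    rfl

end Pi

/-! ### Presentations of `End M`-modules by maps between powers of `M`. -/

section Presentation

variable {A : Type*} [Ring A] {M : Type*} [AddCommGroup M] [Module A M]

theorem eq_sum_single_comp {m : ℕ} (φ : M →ₗ[A] (Fin m → M)) :
    φ = ∑ l, LinearMap.single A (fun _ : Fin m => M) l ∘ₗ (LinearMap.proj l ∘ₗ φ) := by
  ext x i
  simp [LinearMap.sum_apply, Finset.sum_apply, Pi.single_apply]

/-- The coordinate inclusions `M → M^m` generate. -/
theorem finite_hom_pi (m : ℕ) :
    Module.Finite (Module.End A M)ᵐᵒᵖ (M →ₗ[A] (Fin m → M)) := by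
  refine Module.Finite.of_surjective
    (Fintype.linearCombination (Module.End A M)ᵐᵒᵖ
      (fun l : Fin m => LinearMap.single A (fun _ : Fin m => M) l)) fun φ =>
    ⟨fun l => MulOpposite.op (LinearMap.proj l ∘ₗ φ), ?_⟩
  rw [Fintype.linearCombination_apply]
  exact (eq_sum_single_comp φ).symm

/-- If `End M` is right noetherian, then each finitely generated right `End M`-module is the
cokernel of `Hom(M, M^k) → Hom(M, M^m)` for some map `M^k → M^m`. -/
theorem exists_equiv_homCokernel [IsNoetherianRing (Module.End A M)ᵐᵒᵖ]
    (F : Type*) [AddCommGroup F] [Module (Module.End A M)ᵐᵒᵖ F]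
    [Module.Finite (Module.End A M)ᵐᵒᵖ F] :
    ∃ (k m : ℕ) (f : (Fin k → M) →ₗ[A] (Fin m → M)),
      Nonempty (F ≃ₗ[(Module.End A M)ᵐᵒᵖ] HomCokernel M f) := by
  obtain ⟨m, π, hπ⟩ := Module.Finite.exists_fin' (Module.End A M)ᵐᵒᵖ F
  let t : (M →ₗ[A] (Fin m → M)) →ₗ[(Module.End A M)ᵐᵒᵖ] (Fin m → (Module.End A M)ᵐᵒᵖ) :=
    { toFun := fun φ l => MulOpposite.op (LinearMap.proj l ∘ₗ φ)
      map_add' := fun φ ψ => by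
        ext l : 1
        simp [LinearMap.comp_add]
      map_smul' := fun e φ => rfl }
  have ht : Function.Surjective t := fun y =>
    ⟨LinearMap.pi fun l => (y l).unop, by ext l : 1; exact MulOpposite.unop_injective rfl⟩
  let τ := π ∘ₗ t
  have hτ : Function.Surjective τ := hπ.comp ht
  have := finite_hom_pi (A := A) (M := M) m
  obtain ⟨k, g, hg⟩ := Submodule.fg_iff_exists_fin_generating_family.1
    (IsNoetherian.noetherian (LinearMap.ker τ))
  -- The generators `g i : M → M^m` of the kernel of `τ` are the components of `f`.
  let f : (Fin k → M) →ₗ[A] (Fin m → M) := LinearMap.lsum A (fun _ => M) ℕ g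
  refine ⟨k, m, f, ⟨(τ.quotKerEquivOfSurjective hτ).symm ≪≫ₗ Submodule.quotEquivOfEq _ _ ?_⟩⟩
  rw [← hg]
  apply le_antisymm
  · rw [Submodule.span_le]
    rintro _ ⟨i, rfl⟩
    refine ⟨LinearMap.single A (fun _ : Fin k => M) i, ?_⟩
    ext x : 1
    simp only [f, postcomp_apply, LinearMap.comp_apply, LinearMap.lsum_apply, LinearMap.sum_apply,
      LinearMap.proj_apply, LinearMap.single_apply]
    rw [Finset.sum_eq_single i (fun j _ hj => by rw [Pi.single_eq_of_ne hj, map_zero]) (by simp),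
      Pi.single_eq_same]
  · rintro _ ⟨ψ, rfl⟩
    have : postcomp M f ψ = ∑ i, MulOpposite.op (LinearMap.proj i ∘ₗ ψ) • g i := by
      ext x : 1
      simp [f, op_smul_eq_comp]
    rw [this]
    exact Submodule.sum_mem _ fun i _ => Submodule.smul_mem _ _ (Submodule.subset_span ⟨i, rfl⟩)

end Presentation

/-! ### From stable modules to `Ext¹(M, -)`. -/

section

variable {A : Type u} [Ring A] {M : ModuleCat.{u} A}

/-- If `A` is in `add M`, and the Hom-cokernel of `f` is annihilated by the maps that factor through
a projective, then `f` is onto. -/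
theorem surjective_of_homCokernel {k m : ℕ} (f : (Fin k → M) →ₗ[A] (Fin m → M))
    (hA : addClosure M (ModuleCat.of A A))
    (hf : ∀ e : Module.End A M, FactorsThroughProjective e →
      ∀ x : HomCokernel M f, MulOpposite.op e • x = 0) : Function.Surjective f := by
  obtain ⟨j, s, r, hrs⟩ := hA
  intro x
  let h : A →ₗ[A] (Fin m → M) := LinearMap.toSpanSingleton A _ x
  -- The coordinates of `h ∘ q` are endomorphisms of `M` through the projective `A`, so they kill
  -- the classes of the coordinate inclusions.
  have key : ∀ q : M →ₗ[A] A, h ∘ₗ q ∈ LinearMap.range (postcomp M f) := by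
    intro q
    rw [eq_sum_single_comp (h ∘ₗ q)]
    refine Submodule.sum_mem _ fun l _ => ?_
    have := hf (LinearMap.proj l ∘ₗ (h ∘ₗ q))
      ⟨ModuleCat.of A A, inferInstanceAs (Module.Finite A A), inferInstanceAs (Module.Projective A A),
        q, LinearMap.proj l ∘ₗ h, rfl⟩
      (Submodule.Quotient.mk (LinearMap.single A (fun _ : Fin m => M) l))
    rwa [← Submodule.Quotient.mk_smul, Submodule.Quotient.mk_eq_zero] at this
  -- Apply `h` to `1 = r (s 1)`, split over the coordinates of `M^j`.
  have hx : x = ∑ i, h (r (LinearMap.single A (fun _ : Fin j => M) i (s (1 : A) i))) := by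
    rw [← map_sum, ← map_sum]
    have h1 : ∑ i, LinearMap.single A (fun _ : Fin j => M) i (s (1 : A) i) = s (1 : A) := by
      ext i
      simp [Finset.sum_apply, Pi.single_apply]
    rw [h1]
    have h2 : r (s (1 : A)) = (1 : A) := LinearMap.congr_fun hrs (1 : A)
    rw [h2]
    simp [h]
  rw [← LinearMap.mem_range, hx]
  refine Submodule.sum_mem _ fun i _ => ?_
  obtain ⟨ψ, hψ⟩ := key (r ∘ₗ LinearMap.single A (fun _ : Fin j => M) i)
  exact ⟨ψ (s (1 : A) i), LinearMap.congr_fun hψ (s (1 : A) i)⟩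

/-- An epimorphism onto the projective module `A` splits. -/
theorem addClosure_self_of_generating
    (h : ∃ (Y : ModuleCat.{u} A) (π : Y ⟶ ModuleCat.of A A), addClosure M Y ∧ Epi π) :
    addClosure M (ModuleCat.of A A) := by
  obtain ⟨Y, π, ⟨k, s, r, hrs⟩, hπ⟩ := h
  have hs := (ModuleCat.epi_iff_surjective π).1 hπ
  obtain ⟨t, ht⟩ := Module.projective_lifting_property π.hom (LinearMap.id : A →ₗ[A] A) hs
  refine ⟨k, s ∘ₗ t, π.hom ∘ₗ r, ?_⟩
  rw [LinearMap.comp_assoc, ← LinearMap.comp_assoc t s r, hrs, LinearMap.id_comp, ht]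

theorem addClosure_pi (k : ℕ) : addClosure M (ModuleCat.of A (Fin k → M)) :=
  ⟨k, LinearMap.id, LinearMap.id, rfl⟩

/-- The projection of an injective module containing `N` onto the quotient by `N`. -/
noncomputable abbrev cosyzygyMap (N : ModuleCat.{u} A) :
    (Injective.under N :) →ₗ[A] ((Injective.under N :) ⧸ LinearMap.range (Injective.ι N).hom) :=
  Submodule.mkQ _

/-- The right `End M`-module `Ext¹(M, N)`. -/
noncomputable abbrev ExtModule (M N : ModuleCat.{u} A) : Type u := HomCokernel M (cosyzygyMap N)

/-- If `f` is onto with kernel `∏ N i`, and `Ext¹(M, Y) = 0`, then the Hom-cokernel of `f : Y → Z` is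
the product of the `Ext¹(M, N i)`. -/
theorem nonempty_homCokernel_equiv_pi_extModule {Y Z : Type u} [AddCommGroup Y] [Module A Y]
    [AddCommGroup Z] [Module A Z] (hY : LiftsAlongExtensionsBy (A := A) M Y)
    (f : Y →ₗ[A] Z) (hf : Function.Surjective f) {ι : Type} (N : ι → ModuleCat.{u} A)
    (e : LinearMap.ker f ≃ₗ[A] ∀ i, N i) :
    Nonempty (HomCokernel M f ≃ₗ[(Module.End A M)ᵐᵒᵖ] ∀ i, ExtModule M (N i)) := by
  -- Injectivity extends `ker f → N i → I (N i)` to all of `Y`; together these maps compare `f` with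
  -- the product of the cosyzygy maps.
  have hext : ∀ i, ∃ u : Y →ₗ[A] (Injective.under (N i) :), ∀ y : LinearMap.ker f,
      u y = (Injective.ι (N i)).hom (e y i) := by
    intro i
    let j : ModuleCat.of A (LinearMap.ker f) ⟶ ModuleCat.of A Y :=
      ModuleCat.ofHom (LinearMap.ker f).subtype
    have : Mono j := (ModuleCat.mono_iff_injective j).2 Subtype.val_injective
    let t : ModuleCat.of A (LinearMap.ker f) ⟶ Injective.under (N i) :=
      ModuleCat.ofHom (LinearMap.proj i ∘ₗ e.toLinearMap) ≫ Injective.ι (N i)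
    refine ⟨(Injective.factorThru t j).hom, fun y => ?_⟩
    exact LinearMap.congr_fun (congrArg ModuleCat.Hom.hom (Injective.comp_factorThru t j)) y
  choose u hu using hext
  obtain ⟨T⟩ := nonempty_homCokernel_piMap_equiv M fun i => cosyzygyMap (N i)
  have hinj : ∀ i, Function.Injective (Injective.ι (N i)).hom := fun i =>
    (ModuleCat.mono_iff_injective _).1 inferInstance
  obtain ⟨T'⟩ := nonempty_homCokernel_equiv hY f (LinearMap.piMap fun i => cosyzygyMap (N i))
    (LinearMap.pi u) hf
    (by
      intro c
      choose w hw using fun i => Submodule.mkQ_surjective _ (c i)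
      exact ⟨w, funext hw⟩)
    (by
      intro y hy
      ext i
      refine (Submodule.Quotient.mk_eq_zero _).2 ?_
      exact ⟨e ⟨y, hy⟩ i, (hu i ⟨y, hy⟩).symm⟩)
    (by
      intro y hy h0
      have : e ⟨y, hy⟩ = 0 := by
        ext i
        apply hinj i
        rw [← hu i ⟨y, hy⟩]
        exact (congrFun h0 i).trans (map_zero _).symm
      exact congrArg Subtype.val (e.injective (this.trans (map_zero e).symm)))
    (by
      intro w hw
      have : ∀ i, ∃ x, (Injective.ι (N i)).hom x = w i := fun i =>
        (Submodule.Quotient.mk_eq_zero _).1 (congrFun hw i)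
      choose x hx using this
      refine ⟨e.symm x, (e.symm x).2, ?_⟩
      ext i
      rw [← hx i]
      refine (hu i (e.symm x)).trans ?_
      rw [e.apply_symm_apply])
  exact ⟨T' ≪≫ₗ T⟩

/-- A ring homomorphism from `(End M)ᵒᵖ` onto the opposite of the stable endomorphism ring. -/
def toStableEndOp (M : ModuleCat.{u} A) : (Module.End A M)ᵐᵒᵖ →+* (StableEnd M)ᵐᵒᵖ :=
  RingHom.op (projectiveIdeal M).ringCon.mk'

theorem toStableEndOp_surjective : Function.Surjective (toStableEndOp M) := by
  intro x
  obtain ⟨y, hy⟩ := (projectiveIdeal M).ringCon.mk'_surjective x.unop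
  exact ⟨MulOpposite.op y, MulOpposite.unop_injective hy⟩

theorem toStableEndOp_eq_zero {e : Module.End A M} (he : FactorsThroughProjective e) :
    toStableEndOp M (MulOpposite.op e) = 0 := by
  apply MulOpposite.unop_injective
  have h : e ∈ projectiveIdeal M := mem_projectiveIdeal.2 he
  exact (RingCon.eq _).2 ((TwoSidedIdeal.mem_iff _ _).1 h)

end

/-! ### Linearity over a quotient ring. -/

section Restriction

variable {B S : Type*} [Ring B] [Ring S] (ρ : B →+* S) (hρ : Function.Surjective ρ)
  {F G : Type*} [AddCommGroup F] [AddCommGroup G] [Module B F] [Module B G] [Module S F]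
  [Module S G]

/-- A map that is linear over `B` is linear over each quotient of `B`. -/
def extendLinear (hρ : Function.Surjective ρ) (hF : ∀ (b : B) (x : F), b • x = ρ b • x)
    (hG : ∀ (b : B) (x : G), b • x = ρ b • x) (f : F →ₗ[B] G) : F →ₗ[S] G where
  toFun := f
  map_add' := map_add f
  map_smul' s x := by
    obtain ⟨b, rfl⟩ := hρ s
    rw [← hF, map_smul, hG, RingHom.id_apply]

end Restriction

/-! ### The injection on classes of indecomposables. -/

section Main

variable {A : Type u} [Ring A] {M : ModuleCat.{u} A}

/-- If `End M` is right noetherian, `A` has finite length, `A ∈ add M` and `Ext¹(M, M^k) = 0` for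
all `k`, then each indecomposable right module over the stable endomorphism ring is
isomorphic to `Ext¹(M, N)`, where `N` is the chosen representative of a class of indecomposables. -/
theorem exists_equiv_extModule [IsNoetherianRing A] [IsArtinianRing A] [Module.Finite A M]
    [IsNoetherianRing (Module.End A M)ᵐᵒᵖ] (hA : addClosure M (ModuleCat.of A A))
    (hM : ∀ k : ℕ, LiftsAlongExtensionsBy (A := A) M (Fin k → M))
    (F : ModuleCat.{u} (StableEnd M)ᵐᵒᵖ) [Module.Finite (StableEnd M)ᵐᵒᵖ F]
    (hF : Indecomposable F) [Module (Module.End A M)ᵐᵒᵖ F]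
    (hsmul : ∀ (b : (Module.End A M)ᵐᵒᵖ) (x : F), b • x = toStableEndOp M b • x) :
    ∃ c ∈ indecomposableClasses A,
      Nonempty (F ≃ₗ[(Module.End A M)ᵐᵒᵖ] ExtModule M (Quotient.out c)) := by
  have hfin : Module.Finite (Module.End A M)ᵐᵒᵖ F := by
    obtain ⟨s, hs⟩ := Module.Finite.fg_top (R := (StableEnd M)ᵐᵒᵖ) (M := F)
    refine ⟨s, ?_⟩
    rw [eq_top_iff]
    intro x _
    have hx : x ∈ Submodule.span (StableEnd M)ᵐᵒᵖ (s : Set F) := hs ▸ Submodule.mem_top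
    induction hx using Submodule.span_induction with
    | mem y hy => exact Submodule.subset_span hy
    | zero => exact zero_mem _
    | add y z _ _ h₁ h₂ => exact add_mem (h₁ trivial) (h₂ trivial)
    | smul a y _ h₁ =>
      obtain ⟨b, rfl⟩ := toStableEndOp_surjective a
      rw [← hsmul]
      exact Submodule.smul_mem _ _ (h₁ trivial)
  obtain ⟨k, m, f, ⟨e⟩⟩ := exists_equiv_homCokernel (A := A) (M := M) F
  have hf : Function.Surjective f := surjective_of_homCokernel f hA fun d hd x => by
    obtain ⟨y, rfl⟩ := e.surjective x
    rw [← map_smul, hsmul, toStableEndOp_eq_zero hd, zero_smul, map_zero]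
  obtain ⟨ι, _, N, hN, ⟨eN⟩⟩ :=
    exists_equiv_pi_indecomposable (ModuleCat.of A (LinearMap.ker f))
  let c : ι → Quotient (isIsomorphicSetoid (ModuleCat.{u} A)) := fun i => Quotient.mk _ (N i)
  have hc : ∀ i, Nonempty (N i ≃ₗ[A] (Quotient.out (c i) : ModuleCat.{u} A)) := fun i => by
    obtain ⟨j⟩ := Quotient.exact (Quotient.out_eq (c i))
    exact ⟨j.symm.toLinearEquiv⟩
  have w := fun i => (hc i).some
  obtain ⟨T⟩ := nonempty_homCokernel_equiv_pi_extModule (hM k) f hf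
    (fun i => (Quotient.out (c i) : ModuleCat.{u} A))
    (eN ≪≫ₗ LinearEquiv.piCongrRight fun i => w i)
  have := Indecomposable.nontrivial hF
  obtain ⟨i, hi⟩ := exists_equiv_of_equiv_pi (B := (Module.End A M)ᵐᵒᵖ) (F := F)
    -- `F` has the same endomorphisms over `End M` as over its stable quotient, so its idempotents
    -- stay trivial.
    (fun d hd => by
      let d' : Module.End (StableEnd M)ᵐᵒᵖ F :=
        extendLinear (toStableEndOp M) toStableEndOp_surjective hsmul hsmul d
      have hd' : IsIdempotentElem d' := by
        ext x
        exact LinearMap.congr_fun hd x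
      rcases Indecomposable.eq_zero_or_eq_one hF hd' with h | h
      · exact .inl (LinearMap.ext fun x => LinearMap.congr_fun h x)
      · exact .inr (LinearMap.ext fun x => LinearMap.congr_fun h x))
    (e ≪≫ₗ T)
  exact ⟨c i, ⟨N i, (hN i).1, (hN i).2, rfl⟩, hi⟩

/-- Sending `F` to the class of an `N` with `F ≅ Ext¹(M, N)` is injective, since `N` determines `F`
over `End M` and hence over the quotient. -/
theorem finite_indecomposableClasses_stableEnd [IsNoetherianRing A] [IsArtinianRing A]
    [Module.Finite A M] [IsNoetherianRing (Module.End A M)ᵐᵒᵖ]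
    (hA : addClosure M (ModuleCat.of A A))
    (hM : ∀ k : ℕ, LiftsAlongExtensionsBy (A := A) M (Fin k → M))
    (h : (indecomposableClasses A).Finite) : FiniteRepType (StableEnd M) := by
  have key : ∀ d : indecomposableClasses (StableEnd M)ᵐᵒᵖ, ∃ c : indecomposableClasses A,
      ∃ (F : ModuleCat.{u} (StableEnd M)ᵐᵒᵖ) (_ : Module (Module.End A M)ᵐᵒᵖ F),
        Quotient.mk _ F = d.1 ∧ (∀ (b : (Module.End A M)ᵐᵒᵖ) (x : F),
          b • x = toStableEndOp M b • x) ∧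
        Nonempty (F ≃ₗ[(Module.End A M)ᵐᵒᵖ] ExtModule M (Quotient.out c.1)) := by
    rintro ⟨_, F, hfin, hF, rfl⟩
    let : Module (Module.End A M)ᵐᵒᵖ F := Module.compHom F (toStableEndOp M)
    obtain ⟨c, hc, he⟩ := exists_equiv_extModule hA hM F hF fun _ _ => rfl
    exact ⟨⟨c, hc⟩, F, inferInstance, rfl, fun _ _ => rfl, he⟩
  choose g hg using key
  have : Finite (indecomposableClasses A) := h
  refine Finite.of_injective g fun d d' hdd => ?_
  obtain ⟨F, _, hF, hs, ⟨e⟩⟩ := hg d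
  obtain ⟨F', _, hF', hs', ⟨e'⟩⟩ := hg d'
  rw [← hdd] at e'
  let t := e ≪≫ₗ e'.symm
  apply Subtype.ext
  rw [← hF, ← hF']
  refine Quotient.sound ⟨LinearEquiv.toModuleIso (LinearEquiv.ofLinearMap
    (extendLinear (toStableEndOp M) toStableEndOp_surjective hs hs' t.toLinearMap)
    (extendLinear (toStableEndOp M) toStableEndOp_surjective hs' hs t.symm.toLinearMap) ?_ ?_)⟩
  · ext x
    exact t.apply_symm_apply x
  · ext x
    exact t.symm_apply_apply x

end Main

/-- The endomorphism ring of a finitely generated module over an algebra that is finite over a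
commutative noetherian ring is right noetherian. -/
theorem isNoetherianRing_end_op (R : Type*) [CommRing R] [IsNoetherianRing R] {A : Type*} [Ring A]
    [Algebra R A] [Module.Finite R A] (M : Type*) [AddCommGroup M] [Module A M]
    [Module.Finite A M] : IsNoetherianRing (Module.End A M)ᵐᵒᵖ := by
  let : Module R M := Module.compHom M (algebraMap R A)
  have : IsScalarTower R A M := IsScalarTower.of_algebraMap_smul fun _ _ => rfl
  have : Module.Finite R M := Module.Finite.trans A M
  -- `End_A M` embeds in `End_R M`, which is noetherian over `R`.
  have : IsNoetherian R (Module.End A M) :=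
    isNoetherian_of_injective (LinearMap.restrictScalarsₗ R A M M R)
      (LinearMap.restrictScalars_injective R)
  have : IsNoetherian R (Module.End A M)ᵐᵒᵖ :=
    isNoetherian_of_linearEquiv (MulOpposite.opLinearEquiv R : Module.End A M ≃ₗ[R] _)
  exact isNoetherian_of_tower R inferInstance

end RepTheory

/-- Let `Λ` be an artin algebra over the commutative artinian ring `R`, `n ≥ 2`, and `M` an
`n`-cluster tilting right `Λ`-module. If `Λ` is of finite representation type, then so is the
stable endomorphism ring of `M`. -/
theorem mainTheorem10 {R : Type*} [CommRing R] [IsArtinianRing R]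
    {Λ : Type u} [Ring Λ] [Algebra R Λ] [Module.Finite R Λ]
    (n : ℕ) (hn : 2 ≤ n) (M : ModuleCat.{u} Λᵐᵒᵖ)
    (hM : RepTheory.IsClusterTiltingModule n M)
    (hΛ : RepTheory.FiniteRepType Λ) :
    RepTheory.FiniteRepType (RepTheory.StableEnd M) := by
  obtain ⟨hfin, hct⟩ := hM
  have : Module.Finite R Λᵐᵒᵖ := Module.Finite.equiv (MulOpposite.opLinearEquiv R)
  have : IsNoetherianRing Λᵐᵒᵖ := isNoetherian_of_tower R inferInstance
  have : IsArtinianRing Λᵐᵒᵖ := isArtinian_of_tower R inferInstance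
  have := RepTheory.isNoetherianRing_end_op R (A := Λᵐᵒᵖ) M
  have hadd : ∀ k, RepTheory.addClosure M (ModuleCat.of Λᵐᵒᵖ (Fin k → M)) :=
    RepTheory.addClosure_pi
  refine RepTheory.finite_indecomposableClasses_stableEnd
    (RepTheory.addClosure_self_of_generating
      (hct.generating _ (inferInstanceAs (Module.Finite Λᵐᵒᵖ Λᵐᵒᵖ))))
    (fun k => RepTheory.liftsAlongExtensionsBy_of_subsingleton_ext
      (Y := ModuleCat.of Λᵐᵒᵖ (Fin k → M)) ?_) hΛ
  -- Degree `1` lies in the range `0 < i < n` because `n ≥ 2`.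
  refine (hct.right_perp _ (hct.finite _ (hadd k))).1 (hadd k) M ?_ 1 one_pos hn
  exact ⟨1, LinearMap.pi fun _ => LinearMap.id, LinearMap.proj 0, rfl⟩
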